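/- Let $\Gamma$ be a quiver with $n$ vertices and let $\boldsymbol\alpha=(\alpha_1,\dots,\alpha_n)\in\mathbb N^n$, $\boldsymbol\alpha\ne \mathbf 0$. Write $|\boldsymbol\alpha|=\sum_i\alpha_i$, $\boldsymbol\alpha!=\prod_i\alpha_i!$, $\overline{\boldsymbol\alpha}=\gcd(\alpha_1,\dots,\alpha_n)$, let $\boldsymbol u=(u_{ij})_{1\le i\le j\le n}$ be variables, and for $d \geq 1$ put $\boldsymbol u^d=(u_{ij}^d)$. For partitions $\lambda,\mu$ with transposes $\lambda',\mu'$ let $\langle\lambda,\mu\rangle=\sum_{i\ge1}\lambda_i'\mu_i'$ and $b_\lambda(q)=\prod_{i\ge1}\prod_{1\le j\le n_i(\lambda)}(1-q^j)$, where $n_i(\lambda)$ is the number of parts of $\lambda$ equal to $i$. Define $P_\Gamma$, $H_\Gamma$, $A_\Gamma$ (which depend on $\Gamma$ only through $n$) by $$P_\Gamma(\boldsymbol T,\boldsymbol u,q)=\sum_{\lambda^1,\dots,\lambda^n}\frac{\prod_{1\le i\le j\le n}u_{ij}^{\langle\lambda^i,\lambda^j\rangle}}{\prod_{i=1}^n q^{\langle\lambda^i,\lambda^i\rangle}b_{\lambda^i}(q^{-1})}\,T_1^{|\lambda^1|}\cdots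 T_n^{|\lambda^n|},$$ the sum being over all $n$-tuples of partitions, $$\log P_\Gamma(\boldsymbol T,\boldsymbol u,q)=\sum_{\mathbf 0\ne\boldsymbol\alpha\in\mathbb N^n}\frac{H_\Gamma(\boldsymbol\alpha,\boldsymbol u,q)}{\overline{\boldsymbol\alpha}}\,\boldsymbol T^{\boldsymbol\alpha},\qquad A_\Gamma(\boldsymbol\alpha,\boldsymbol u,q)=\frac{q-1}{\overline{\boldsymbol\alpha}}\sum_{d\mid\overline{\boldsymbol\alpha}}\mu(d)\,H_\Gamma(\boldsymbol\alpha/d,\boldsymbol u^d,q^d).$$ For $\boldsymbol k=(k_{ij})_{1\le i\le j\le n}\in\mathbb N^{n(n+1)/2}$ write $|\boldsymbol k|=\sum_{i\le j}k_{ij}$, $t(\boldsymbol k)=\sum_i k_{ii}$ and $(\boldsymbol u-\boldsymbol 1)^{\boldsymbol k}=\prod_{i\le j}(u_{ij}-1)^{k_{ij}}$. Let $G^{\boldsymbol\alpha}_{\boldsymbol k}$ be the number of connected simple graphs on a fixed vertex set $V_1\sqcup\dots\sqcup V_n$ with $|V_i|=\alpha_i$ that have exactly $k_{ij}$ edges between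 $V_i$ and $V_j$ for all $i\le j$ (for $i=j$: edges with both ends in $V_i$). Let $S_{\boldsymbol k}$ be the set of $\boldsymbol p\in\mathbb N^{n(n+1)/2}$ with $p_{ii}\le k_{ii}$ for all $i$ and $p_{ij}=k_{ij}$ for all $i<j$, and for $\boldsymbol p\in S_{\boldsymbol k}$ let $$c^{\boldsymbol\alpha}_{\boldsymbol k\boldsymbol p}=\prod_{i=1}^n\Bigl(\sum_{j=0}^{\infty}\binom{p_{ii}}{j}\binom{\alpha_i}{k_{ii}-p_{ii}-j}2^{p_{ii}-j}\Bigr),$$ where $\binom{a}{b}=0$ for $b<0$. **Proposition.** The limit $\lim_{q\to1}(q-1)^{|\boldsymbol\alpha|-1}A_\Gamma(\boldsymbol\alpha,\boldsymbol u,q)$ (over real or complex $q\ne1$, for all real or complex values of the $u_{ij}$, respectively) exists and is a polynomial in $\boldsymbol u$. For every $\boldsymbol k\in\mathbb N^{n(n+1)/2}$, the coefficient of $(\boldsymbol u-\boldsymbol 1)^{\boldsymbol k}$ in this polynomial equals $$\frac1{\boldsymbol\alpha!}\sum_{\boldsymbol p\in S_{\boldsymbol k}}c^{\boldsymbol\alpha}_{\boldsymbol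 k\boldsymbol p}\,G^{\boldsymbol\alpha}_{\boldsymbol p}.$$ In particular, if $|\boldsymbol k|=|\boldsymbol\alpha|-1$, this coefficient equals $\dfrac{1}{\boldsymbol\alpha!}\,2^{t(\boldsymbol k)}\,G^{\boldsymbol\alpha}_{\boldsymbol k}$. -/

import Mathlib

noncomputable section

namespace QuiverDeformation

/-- The index set `{(i, j) : 1 ≤ i ≤ j ≤ n}`; it has `n (n + 1) / 2` elements, and `Pairs n → M`
is the set of vectors `(u_ij)` with `i ≤ j`. -/
abbrev Pairs (n : ℕ) : Type := {p : Fin n × Fin n // p.1 ≤ p.2}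

/-- The diagonal index `(i, i)`. -/
def diag {n : ℕ} (i : Fin n) : Pairs n := ⟨(i, i), le_refl i⟩

/-! ### Partitions -/

/-- The part `λ'_i` (`i ≥ 1`) of the transpose of the partition `λ`: the number of parts of `λ`
that are at least `i`. -/
def conjPart {a : ℕ} (l : Nat.Partition a) (i : ℕ) : ℕ :=
  (l.parts.filter (fun x => i ≤ x)).card

theorem conjPart_eq_zero {a : ℕ} (l : Nat.Partition a) {i : ℕ} (hi : a < i) :
    conjPart l i = 0 := by
  unfold conjPart
  rw [Multiset.card_eq_zero, Multiset.filter_eq_nil]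
  intro x hx h
  have h1 : x ≤ l.parts.sum := Multiset.single_le_sum (fun _ _ => Nat.zero_le _) x hx
  rw [l.parts_sum] at h1
  omega

/-- `⟨λ, μ⟩ = ∑_{i ≥ 1} λ'_i μ'_i`; the terms with `i > |λ|` vanish (`conjPart_eq_zero`). -/
def pairing {a b : ℕ} (l : Nat.Partition a) (m : Nat.Partition b) : ℕ :=
  ∑ i ∈ Finset.Icc 1 a, conjPart l i * conjPart m i

/-- `b_λ(q) = ∏_{i ≥ 1} ∏_{1 ≤ j ≤ n_i} (1 - q ^ j)`, where `n_i` is the number of parts of `λ`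
equal to `i`; the factors with `i > |λ|` are empty products. -/
def bPart {K : Type*} [Field K] {a : ℕ} (l : Nat.Partition a) (q : K) : K :=
  ∏ i ∈ Finset.Icc 1 a, ∏ j ∈ Finset.Icc 1 (l.parts.count i), (1 - q ^ j)

/-! ### The functions `P_Γ(T, u, q)`, `H_Γ(α, u, q)` and `A_Γ(α, u, q)`

The quiver `Γ` enters only through the number `n` of its vertices. -/

/-- `P_Γ(T, u, q)`, a power series in `T_1, …, T_n`: the coefficient of `T ^ α` is the sum over all
`n`-tuples of partitions with `|λ^i| = α_i`. -/
def PSeries {K : Type*} [Field K] {n : ℕ} (u : Pairs n → K) (q : K) : MvPowerSeries (Fin n) K :=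
  fun α => ∑ l : (i : Fin n) → Nat.Partition (α i),
    (∏ p : Pairs n, u p ^ pairing (l p.1.1) (l p.1.2)) /
      ∏ i : Fin n, (q ^ pairing (l i) (l i) * bPart (l i) q⁻¹)

/-- The constant term of `P_Γ(T, u, q)` is `1`, so that its logarithm is defined. -/
theorem constantCoeff_PSeries {K : Type*} [Field K] {n : ℕ} (u : Pairs n → K) (q : K) :
    MvPowerSeries.constantCoeff (PSeries u q) = 1 := by
  have h : MvPowerSeries.constantCoeff (PSeries u q) = PSeries u q 0 := rfl
  rw [h]
  unfold PSeries
  have h0 : ∀ i : Fin n, (0 : Fin n →₀ ℕ) i = 0 := fun i => rfl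
  simp [pairing, bPart, h0]

/-- The logarithm of a power series in several variables with constant term `1`:
`log F = ∑_{m ≥ 1} (-1) ^ (m + 1) (F - 1) ^ m / m`. -/
def mvLog {K : Type*} [Field K] [CharZero K] {n : ℕ} (F : MvPowerSeries (Fin n) K) :
    MvPowerSeries (Fin n) K :=
  PowerSeries.subst (F - 1) (PowerSeries.log K)

/-- `gcd(α_1, …, α_n)`. -/
def gcdVec {n : ℕ} (α : Fin n → ℕ) : ℕ := Finset.univ.gcd α

/-- `H_Γ(α, u, q)`, from `log P_Γ(T, u, q) = ∑_{α ≠ 0} (H_Γ(α, u, q) / gcd(α)) T ^ α`. -/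
def HFun {K : Type*} [Field K] [CharZero K] {n : ℕ} (α : Fin n → ℕ) (u : Pairs n → K) (q : K) :
    K :=
  (gcdVec α : K) *
    MvPowerSeries.coeff (Finsupp.equivFunOnFinite.symm α) (mvLog (PSeries u q))

/-- `A_Γ(α, u, q) = ((q - 1) / gcd(α)) ∑_{d ∣ gcd(α)} μ(d) H_Γ(α / d, u ^ d, q ^ d)`, where
`u ^ d` is the vector with the components `u_ij ^ d`. -/
def AFun {K : Type*} [Field K] [CharZero K] {n : ℕ} (α : Fin n → ℕ) (u : Pairs n → K) (q : K) :
    K :=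
  (q - 1) / (gcdVec α : K) *
    ∑ d ∈ (gcdVec α).divisors,
      ((ArithmeticFunction.moebius d : ℤ) : K) *
        HFun (fun i => α i / d) (fun p => u p ^ d) (q ^ d)

/-! ### Connected graphs -/

/-- The number `G_k^α` of connected (simple, labelled) graphs on the disjoint union of the sets
`V_1, …, V_n` with `|V_i| = α_i` that have exactly `k_ij` edges between `V_i` and `V_j` for all
`i ≤ j` (for `i = j`: edges with both ends in `V_i`). -/
def connGraphCount {n : ℕ} (α : Fin n → ℕ) (k : Pairs n → ℕ) : ℕ :=
  Nat.card {G : SimpleGraph ((i : Fin n) × Fin (α i)) //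
    G.Connected ∧
      ∀ p : Pairs n, {e ∈ G.edgeSet | e.map Sigma.fst = s(p.1.1, p.1.2)}.ncard = k p}

/-! ### The combinatorial coefficients -/

/-- `S_k`: all `p` with `p_ii ≤ k_ii` and `p_ij = k_ij` for `i < j`; see `mem_SSet`. -/
def SSet {n : ℕ} (k : Pairs n → ℕ) : Finset (Pairs n → ℕ) :=
  (Finset.Iic k).filter (fun p => ∀ e : Pairs n, e.1.1 < e.1.2 → p e = k e)

theorem mem_SSet {n : ℕ} (k p : Pairs n → ℕ) :
    p ∈ SSet k ↔ (∀ i : Fin n, p (diag i) ≤ k (diag i)) ∧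
      ∀ e : Pairs n, e.1.1 < e.1.2 → p e = k e := by
  simp only [SSet, Finset.mem_filter, Finset.mem_Iic]
  constructor
  · rintro ⟨h1, h2⟩
    exact ⟨fun i => h1 (diag i), h2⟩
  · rintro ⟨h1, h2⟩
    refine ⟨fun e => ?_, h2⟩
    obtain ⟨⟨i, j⟩, hij⟩ := e
    rcases lt_or_eq_of_le hij with h | h
    · exact (h2 ⟨(i, j), hij⟩ h).le
    · have h' : i = j := h
      subst h'
      exact h1 i

/-- `c^α_{kp} = ∏_i ∑_{j ≥ 0} C(p_ii, j) C(α_i, k_ii - p_ii - j) 2 ^ (p_ii - j)` for `p ∈ S_k`.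
The sum stops at `j = k_ii - p_ii`, since a binomial coefficient with negative lower index is `0`;
the terms with `j > p_ii` vanish because `C(p_ii, j) = 0`. -/
def cCoeff {n : ℕ} (α : Fin n → ℕ) (k p : Pairs n → ℕ) : ℕ :=
  ∏ i : Fin n, ∑ j ∈ Finset.range (k (diag i) - p (diag i) + 1),
    (p (diag i)).choose j * (α i).choose (k (diag i) - p (diag i) - j) * 2 ^ (p (diag i) - j)

/-- `t(k) = ∑_i k_ii`. -/
def tSum {n : ℕ} (k : Pairs n → ℕ) : ℕ := ∑ i : Fin n, k (diag i)

/-- The coefficient of `(u - 1) ^ k = ∏_{i ≤ j} (u_ij - 1) ^ k_ij` in the polynomial `L(u)`, that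
is, the coefficient of `x ^ k` in `L(x + 1)`. -/
def coeffAtOne {K : Type*} [Field K] {n : ℕ} (k : Pairs n → ℕ) (L : MvPolynomial (Pairs n) K) : K :=
  MvPolynomial.coeff (Finsupp.equivFunOnFinite.symm k)
    (MvPolynomial.aeval (fun p : Pairs n => (MvPolynomial.X p + 1 : MvPolynomial (Pairs n) K)) L)

end QuiverDeformation

end

/-! Replace `T` by `(q - 1) T` in `P_Γ`. The denominator `b_λ(q⁻¹)` has one factor vanishing at `q =
1` for each part of `λ`, so `(q - 1) ^ |λ|` divided by it tends to `0` unless all parts of `λ` are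
`1`; for `λ = (1^a)` the limit is `1 / a!`. Hence the rescaled series tends coefficientwise to
`QSeries u`, whose coefficient at `T ^ α` is `∏ u_ij ^ (α_i α_j) / α!`. The logarithm respects
rescaling and coefficientwise limits. In `A_Γ` the terms with `d > 1` have poles of order at most `∑
⌊α_i / d⌋ < |α|` and disappear, so the limit is the coefficient of `log (QSeries u)` at `T ^ α`
(`tendsto_pow_mul_AFun`).

This coefficient counts connected graphs. Since `α_i ^ 2 = α_i + 2 C(α_i, 2)`, the product `∏ u_ij ^
(α_i α_j)` is a weight `u_ii` for each vertex times a factor `1 + w` for each pair of vertices, with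
`w = u_ij - 1` between different colours and `w = u_ii ^ 2 - 1` within one colour. Expanding gives a
sum over all graphs, and by the exponential formula the logarithm keeps the connected ones
(`connSum_eq_coeff_mvLog`).

With `u = x + 1` the weight `u_ii ^ 2 - 1` becomes `x_ii (x_ii + 2)`, and a graph with edge counts
`p` contributes `∏_i (x_ii (x_ii + 2)) ^ p_ii (x_ii + 1) ^ α_i ∏_{i<j} x_ij ^ p_ij`. Its coefficient
at `x ^ k` is `c_kp` (`prod_coeff_colourFactor`). If `|k| = |α| - 1`, every `p ≠ k` in `S_k` has too
few edges for a connected graph. -/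

namespace QuiverDeformation

open Filter Topology

/-! ### Logarithms of power series: truncation, derivative, rescaling, continuity. -/

section Log

variable {K : Type*} [Field K] [CharZero K] {n : ℕ}

/-- The logarithm of a series `F` with constant term `1`, truncated at the `N`-th power
of `F - 1`. -/
noncomputable def truncLog (N : ℕ) (F : MvPowerSeries (Fin n) K) : MvPowerSeries (Fin n) K :=
  ∑ m ∈ Finset.range N, ((-1 : K) ^ m / (m + 1)) • (F - 1) ^ (m + 1)

theorem coeff_mvLog {F : MvPowerSeries (Fin n) K} (hF : MvPowerSeries.constantCoeff F = 1)
    (e : Fin n →₀ ℕ) {N : ℕ} (hN : e.degree ≤ N) :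
    MvPowerSeries.coeff e (mvLog F) = MvPowerSeries.coeff e (truncLog N F) := by
  have h0 : MvPowerSeries.constantCoeff (F - 1) = 0 := by simp [hF]
  unfold mvLog truncLog
  -- The range is `N + 1` because the zeroth coefficient of the logarithm vanishes and `truncLog` is
  -- indexed from the first power.
  rw [PowerSeries.coeff_subst (PowerSeries.HasSubst.of_constantCoeff_zero h0),
    finsum_eq_sum_of_support_subset (s := Finset.range (N + 1)), Finset.sum_range_succ', map_sum]
  · simp only [PowerSeries.coeff_log]
    simp [pow_succ]
  · intro m hm
    simp only [Finset.coe_range, Set.mem_Iio]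
    by_contra! h
    apply hm
    simp only
    rw [MvPowerSeries.coeff_eq_zero_of_constantCoeff_nilpotent (m := 1) (by simp [h0]) (by omega),
      smul_zero]

/-- The derivative of the truncation is `∂F` times the geometric sum of `(1 - F) ^ m`, and `F = 1 -
(1 - F)` makes the sum telescope. -/
theorem mul_pderiv_truncLog (N : ℕ) (i : Fin n) (F : MvPowerSeries (Fin n) K) :
    F * MvPowerSeries.pderiv K i (truncLog N F) =
      MvPowerSeries.pderiv K i F * (1 - (1 - F) ^ N) := by
  have h1 : MvPowerSeries.pderiv K i (truncLog N F) =
      (∑ m ∈ Finset.range N, (1 - F) ^ m) * MvPowerSeries.pderiv K i F := by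
    unfold truncLog
    rw [map_sum, Finset.sum_mul]
    refine Finset.sum_congr rfl fun m _ => ?_
    rw [Derivation.map_smul, MvPowerSeries.pderiv_pow, map_sub, MvPowerSeries.pderiv_one, sub_zero,
      Nat.add_sub_cancel, ← neg_sub F 1, neg_pow (F - 1), MvPowerSeries.smul_eq_C_mul]
    have h2 : (MvPowerSeries.C ((-1 : K) ^ m / (m + 1)) : MvPowerSeries (Fin n) K) *
        ((m + 1 : ℕ) : MvPowerSeries (Fin n) K) = (-1) ^ m := by
      rw [← map_natCast (MvPowerSeries.C (σ := Fin n) (R := K)), ← map_mul]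
      have : (m + 1 : K) ≠ 0 := by exact_mod_cast Nat.succ_ne_zero m
      push_cast
      rw [div_mul_cancel₀ _ this]
      simp
    rw [← h2]
    ring
  have h3 := mul_neg_geom_sum (1 - F) N
  rw [sub_sub_cancel] at h3
  rw [h1, ← mul_assoc, h3, mul_comm]

theorem mul_pderiv_mvLog {F : MvPowerSeries (Fin n) K}
    (hF : MvPowerSeries.constantCoeff F = 1) (i : Fin n) :
    F * MvPowerSeries.pderiv K i (mvLog F) = MvPowerSeries.pderiv K i F := by
  classical
  ext e
  -- The truncation goes one beyond the degree of `e`, because a derivative reads coefficients one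
  -- degree higher. The error `(1 - F) ^ N` then has no terms in degrees up to that of `e`.
  have h1 : MvPowerSeries.coeff e (F * MvPowerSeries.pderiv K i (mvLog F)) =
      MvPowerSeries.coeff e (F * MvPowerSeries.pderiv K i (truncLog (e.degree + 1) F)) := by
    rw [MvPowerSeries.coeff_mul, MvPowerSeries.coeff_mul]
    refine Finset.sum_congr rfl fun p hp => ?_
    have hp := Finset.HasAntidiagonal.mem_antidiagonal.mp hp
    rw [MvPowerSeries.coeff_pderiv, MvPowerSeries.coeff_pderiv, coeff_mvLog hF]
    rw [← hp]
    simp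
  rw [h1, mul_pderiv_truncLog, mul_sub, mul_one, map_sub, sub_eq_self, MvPowerSeries.coeff_mul]
  refine Finset.sum_eq_zero fun p hp => ?_
  have hp := Finset.HasAntidiagonal.mem_antidiagonal.mp hp
  rw [MvPowerSeries.coeff_eq_zero_of_constantCoeff_nilpotent (m := 1) (by simp [hF]), mul_zero]
  rw [← hp]
  simp
  omega

theorem coeff_mvLog_rescale {F : MvPowerSeries (Fin n) K}
    (hF : MvPowerSeries.constantCoeff F = 1) (c : K) (e : Fin n →₀ ℕ) :
    MvPowerSeries.coeff e (mvLog (MvPowerSeries.rescale (fun _ => c) F)) =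
      c ^ e.degree * MvPowerSeries.coeff e (mvLog F) := by
  have hF' : MvPowerSeries.constantCoeff (MvPowerSeries.rescale (fun _ => c) F) = 1 := by
    rw [← MvPowerSeries.coeff_zero_eq_constantCoeff_apply, MvPowerSeries.coeff_rescale]
    simp [hF]
  have h : truncLog e.degree (MvPowerSeries.rescale (fun _ => c) F) =
      MvPowerSeries.rescale (fun _ => c) (truncLog e.degree F) := by
    unfold truncLog
    rw [map_sum]
    refine Finset.sum_congr rfl fun m _ => ?_
    rw [MvPowerSeries.smul_eq_C_mul, MvPowerSeries.smul_eq_C_mul, map_mul, map_pow, map_sub,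
      map_one]
    congr 1
    ext d
    rw [MvPowerSeries.coeff_rescale, MvPowerSeries.coeff_C]
    split_ifs with hd <;> simp [hd]
  rw [coeff_mvLog hF' e le_rfl, h, MvPowerSeries.coeff_rescale, ← coeff_mvLog hF e le_rfl]
  simp [Finsupp.prod, Finset.prod_pow_eq_pow_sum, Finsupp.degree_apply]

/-- At a fixed exponent the logarithm is a polynomial in the series, hence continuous for the
product topology, where convergence is coefficientwise. -/
theorem tendsto_coeff_mvLog [TopologicalSpace K] [IsTopologicalRing K] {ι : Type*} {l : Filter ι}
    {F : ι → MvPowerSeries (Fin n) K} {G : MvPowerSeries (Fin n) K}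
    (hF : ∀ x, MvPowerSeries.constantCoeff (F x) = 1) (hG : MvPowerSeries.constantCoeff G = 1)
    (h : ∀ e, Tendsto (fun x => MvPowerSeries.coeff e (F x)) l (𝓝 (MvPowerSeries.coeff e G)))
    (e : Fin n →₀ ℕ) :
    Tendsto (fun x => MvPowerSeries.coeff e (mvLog (F x))) l
      (𝓝 (MvPowerSeries.coeff e (mvLog G))) := by
  open scoped MvPowerSeries.WithPiTopology in
  simp_rw [fun x => coeff_mvLog (hF x) e le_rfl, coeff_mvLog hG e le_rfl]
  have h' : Tendsto F l (𝓝 G) := (MvPowerSeries.WithPiTopology.tendsto_iff_coeff_tendsto _ _ _).2 h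
  have h2 : Tendsto (fun x => truncLog e.degree (F x)) l (𝓝 (truncLog e.degree G)) := by
    unfold truncLog
    refine tendsto_finsetSum _ fun m _ => ?_
    simp_rw [MvPowerSeries.smul_eq_C_mul]
    exact tendsto_const_nhds.mul ((h'.sub tendsto_const_nhds).pow _)
  exact (MvPowerSeries.WithPiTopology.tendsto_iff_coeff_tendsto _ _ _).1 h2 e

end Log

/-! ### The limit `q → 1`. -/

section Limit

/-- The series `∑_α (∏_{i ≤ j} u_ij ^ (α_i α_j)) / α! T ^ α`. -/
noncomputable def QSeries {K : Type*} [Field K] {n : ℕ} (u : Pairs n → K) :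
    MvPowerSeries (Fin n) K :=
  fun α => (∏ p : Pairs n, u p ^ (α p.1.1 * α p.1.2)) / ((∏ i, (α i).factorial : ℕ) : K)

theorem constantCoeff_QSeries {K : Type*} [Field K] {n : ℕ} (u : Pairs n → K) :
    MvPowerSeries.constantCoeff (QSeries u) = 1 := by
  change QSeries u 0 = 1
  simp [QSeries]

theorem constantCoeff_rescale_PSeries {K : Type*} [Field K] {n : ℕ} (u : Pairs n → K) (q c : K) :
    MvPowerSeries.constantCoeff (MvPowerSeries.rescale (fun _ => c) (PSeries u q)) = 1 := by
  rw [← MvPowerSeries.coeff_zero_eq_constantCoeff_apply, MvPowerSeries.coeff_rescale]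
  simp [constantCoeff_PSeries]

/-- The partition of `a` all of whose parts are `1`. -/
def onesPartition (a : ℕ) : Nat.Partition a where
  parts := Multiset.replicate a 1
  parts_pos h := by rw [Multiset.eq_of_mem_replicate h]; exact one_pos
  parts_sum := by simp

theorem card_parts_le {a : ℕ} (l : Nat.Partition a) : l.parts.card ≤ a := by
  have h := Multiset.card_nsmul_le_sum (s := l.parts) (a := 1) fun x hx => l.parts_pos hx
  simpa [l.parts_sum] using h

theorem eq_onesPartition {a : ℕ} (l : Nat.Partition a) (h : a ≤ l.parts.card) :
    l = onesPartition a := by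
  have hc : l.parts.card = a := (card_parts_le l).antisymm h
  have h2 : ∀ x ∈ l.parts, x = 1 := by
    intro x hx
    obtain ⟨t, ht⟩ := Multiset.exists_cons_of_mem hx
    have h3 := Multiset.card_nsmul_le_sum (s := t) (a := 1) fun y hy =>
      l.parts_pos (by rw [ht]; exact Multiset.mem_cons_of_mem hy)
    have h4 := l.parts_sum
    rw [ht, Multiset.sum_cons] at h4
    rw [ht, Multiset.card_cons] at hc
    have := l.parts_pos hx
    simp at h3
    omega
  ext1
  exact Multiset.eq_replicate.2 ⟨hc, h2⟩

theorem sum_count_parts {a : ℕ} (l : Nat.Partition a) :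
    ∑ i ∈ Finset.Icc 1 a, l.parts.count i = l.parts.card := by
  refine Multiset.sum_count_eq_card fun x hx => Finset.mem_Icc.2 ⟨l.parts_pos hx, ?_⟩
  rw [← l.parts_sum]
  exact Multiset.single_le_sum (fun _ _ => Nat.zero_le _) x hx

theorem conjPart_onesPartition_one (a : ℕ) : conjPart (onesPartition a) 1 = a := by
  rw [conjPart, Multiset.filter_eq_self (p := fun x => 1 ≤ x) |>.2 fun x hx => (onesPartition a).parts_pos hx]
  exact Multiset.card_replicate a 1

theorem pairing_onesPartition (a b : ℕ) : pairing (onesPartition a) (onesPartition b) = a * b := by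
  unfold pairing
  rcases Nat.eq_zero_or_pos a with rfl | ha
  · simp
  rw [Finset.sum_eq_single 1]
  · rw [conjPart_onesPartition_one, conjPart_onesPartition_one]
  · intro i hi hi1
    have : 1 < i := by have := (Finset.mem_Icc.1 hi).1; omega
    rw [conjPart, Multiset.filter_eq_nil.2, Multiset.card_zero, zero_mul]
    intro x hx
    rw [Multiset.eq_of_mem_replicate hx]
    omega
  · intro h
    exact absurd (Finset.mem_Icc.2 ⟨le_rfl, ha⟩) h

variable {𝕜 : Type*} [RCLike 𝕜] {n : ℕ}

theorem tendsto_sub_div_one_sub_inv_pow {j : ℕ} (hj : 1 ≤ j) :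
    Tendsto (fun q : 𝕜 => (q - 1) / (1 - q⁻¹ ^ j)) (𝓝[≠] 1) (𝓝 (1 / (j : 𝕜))) := by
  have h1 : Tendsto (fun q : 𝕜 => q ^ j / ∑ i ∈ Finset.range j, q ^ i) (𝓝[≠] 1)
      (𝓝 (1 / (j : 𝕜))) := by
    have hc : ContinuousAt (fun q : 𝕜 => q ^ j / ∑ i ∈ Finset.range j, q ^ i) 1 := by
      refine ContinuousAt.div (by fun_prop) (by fun_prop) ?_
      simp
      omega
    have := hc.tendsto
    simp only [one_pow, Finset.sum_const, Finset.card_range, nsmul_eq_mul, mul_one] at this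
    exact this.mono_left nhdsWithin_le_nhds
  refine h1.congr' ?_
  have h0 : ∀ᶠ q : 𝕜 in 𝓝[≠] 1, q ≠ 0 :=
    nhdsWithin_le_nhds (eventually_ne_nhds one_ne_zero)
  filter_upwards [h0, self_mem_nhdsWithin] with q hq hq1
  have hq1 : q - 1 ≠ 0 := sub_ne_zero.2 hq1
  have hg := geom_sum_mul q j
  have hpow : q ^ j ≠ 0 := pow_ne_zero _ hq
  have h2 : 1 - q⁻¹ ^ j = (∑ i ∈ Finset.range j, q ^ i) * (q - 1) / q ^ j := by
    rw [hg, inv_pow, sub_div, div_self hpow, one_div]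
  rw [h2, div_div_eq_mul_div, mul_comm (q - 1), mul_div_mul_right _ _ hq1]

/-- Each of the `l.parts.card` factors of `b_λ` absorbs one factor `q - 1`. The leftover power gives
`0 ^ (a - l.parts.card)`, which is `1` exactly when all parts are `1`. -/
theorem tendsto_pow_div_bPart {a : ℕ} (l : Nat.Partition a) (c : ℕ) :
    Tendsto (fun q : 𝕜 => (q - 1) ^ a / (q ^ c * bPart l q⁻¹)) (𝓝[≠] 1)
      (𝓝 (0 ^ (a - l.parts.card) * ∏ i ∈ Finset.Icc 1 a,
        ∏ j ∈ Finset.Icc 1 (l.parts.count i), 1 / (j : 𝕜))) := by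
  have hid : Tendsto (fun q : 𝕜 => q) (𝓝[≠] 1) (𝓝 1) := tendsto_id.mono_left nhdsWithin_le_nhds
  have h1 : Tendsto (fun q : 𝕜 => (q - 1) ^ (a - l.parts.card) / q ^ c * ∏ i ∈ Finset.Icc 1 a,
      ∏ j ∈ Finset.Icc 1 (l.parts.count i), (q - 1) / (1 - q⁻¹ ^ j)) (𝓝[≠] 1)
      (𝓝 ((1 - 1) ^ (a - l.parts.card) / 1 ^ c * ∏ i ∈ Finset.Icc 1 a,
        ∏ j ∈ Finset.Icc 1 (l.parts.count i), 1 / (j : 𝕜))) := by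
    refine Tendsto.mul ?_ ?_
    · exact ((hid.sub tendsto_const_nhds).pow _).div (hid.pow c) (by simp)
    · exact tendsto_finsetProd _ fun i _ => tendsto_finsetProd _ fun j hj =>
        tendsto_sub_div_one_sub_inv_pow (Finset.mem_Icc.1 hj).1
  rw [sub_self, one_pow, div_one] at h1
  refine h1.congr fun q => ?_
  have h2 : ∏ i ∈ Finset.Icc 1 a, ∏ j ∈ Finset.Icc 1 (l.parts.count i), (q - 1) =
      (q - 1) ^ l.parts.card := by
    simp only [Finset.prod_const, Nat.card_Icc, Nat.add_sub_cancel]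
    rw [Finset.prod_pow_eq_pow_sum, sum_count_parts]
  simp only [Finset.prod_div_distrib]
  rw [h2, div_mul_div_comm, ← pow_add, Nat.sub_add_cancel (card_parts_le l)]
  rfl

theorem prod_Icc_one_div_eq (a : ℕ) :
    ∏ j ∈ Finset.Icc 1 a, 1 / (j : 𝕜) = 1 / (a.factorial : 𝕜) := by
  induction a with
  | zero => simp
  | succ a ih =>
    rw [Finset.prod_Icc_succ_top (by omega), ih, Nat.factorial_succ, one_div_mul_one_div, mul_comm]
    push_cast
    rfl

theorem prod_count_onesPartition (a : ℕ) :
    ∏ i ∈ Finset.Icc 1 a, ∏ j ∈ Finset.Icc 1 ((onesPartition a).parts.count i), 1 / (j : 𝕜) =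
      1 / (a.factorial : 𝕜) := by
  rcases Nat.eq_zero_or_pos a with rfl | ha
  · simp
  rw [Finset.prod_eq_single 1]
  · simp only [onesPartition, Multiset.count_replicate_self]
    exact prod_Icc_one_div_eq a
  · intro i _ hi1
    rw [onesPartition, Multiset.count_eq_zero_of_notMem]
    · simp
    · rw [Multiset.mem_replicate]
      tauto
  · intro h
    exact absurd (Finset.mem_Icc.2 ⟨le_rfl, ha⟩) h

theorem tendsto_coeff_rescale_PSeries (u : Pairs n → 𝕜) (e : Fin n →₀ ℕ) :
    Tendsto (fun q : 𝕜 => MvPowerSeries.coeff e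
      (MvPowerSeries.rescale (fun _ => q - 1) (PSeries u q))) (𝓝[≠] 1)
      (𝓝 (MvPowerSeries.coeff e (QSeries u))) := by
  classical
  have h1 : Tendsto (fun q : 𝕜 => ∑ l : (i : Fin n) → Nat.Partition (e i),
      (∏ p : Pairs n, u p ^ pairing (l p.1.1) (l p.1.2)) *
        ∏ i : Fin n, (q - 1) ^ e i / (q ^ pairing (l i) (l i) * bPart (l i) q⁻¹)) (𝓝[≠] 1)
      (𝓝 (∑ l : (i : Fin n) → Nat.Partition (e i),
      (∏ p : Pairs n, u p ^ pairing (l p.1.1) (l p.1.2)) *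
        ∏ i : Fin n, (0 ^ (e i - (l i).parts.card) * ∏ k ∈ Finset.Icc 1 (e i),
        ∏ j ∈ Finset.Icc 1 ((l i).parts.count k), 1 / (j : 𝕜)))) :=
    tendsto_finsetSum _ fun l _ => tendsto_const_nhds.mul
      (tendsto_finsetProd _ fun i _ => tendsto_pow_div_bPart (l i) _)
  have h2 : (∑ l : (i : Fin n) → Nat.Partition (e i),
      (∏ p : Pairs n, u p ^ pairing (l p.1.1) (l p.1.2)) *
        ∏ i : Fin n, (0 ^ (e i - (l i).parts.card) * ∏ k ∈ Finset.Icc 1 (e i),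
        ∏ j ∈ Finset.Icc 1 ((l i).parts.count k), 1 / (j : 𝕜))) =
      MvPowerSeries.coeff e (QSeries u) := by
    -- Any other tuple has some `l i` with fewer than `e i` parts, and its factor is a positive
    -- power of `0`.
    rw [Fintype.sum_eq_single fun i => onesPartition (e i)]
    · simp only [pairing_onesPartition, prod_count_onesPartition]
      change _ = QSeries u e
      simp [QSeries, onesPartition, div_eq_mul_inv]
    · intro l hl
      obtain ⟨i, hi⟩ := Function.ne_iff.1 hl
      rw [Finset.prod_eq_zero (Finset.mem_univ i), mul_zero]
      have : e i - (l i).parts.card ≠ 0 := fun h => hi (eq_onesPartition _ (by omega))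
      rw [zero_pow this, zero_mul]
  rw [h2] at h1
  refine h1.congr fun q => ?_
  rw [MvPowerSeries.coeff_rescale, Finsupp.prod_fintype _ _ (by simp)]
  change _ = _ * PSeries u q e
  rw [PSeries, Finset.mul_sum]
  refine Finset.sum_congr rfl fun l _ => ?_
  rw [Finset.prod_div_distrib]
  ring

theorem tendsto_pow_mul_coeff_mvLog_PSeries (u : Pairs n → 𝕜) (e : Fin n →₀ ℕ) :
    Tendsto (fun q : 𝕜 => (q - 1) ^ e.degree * MvPowerSeries.coeff e (mvLog (PSeries u q)))
      (𝓝[≠] 1) (𝓝 (MvPowerSeries.coeff e (mvLog (QSeries u)))) := by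
  refine (tendsto_coeff_mvLog (fun q : 𝕜 => constantCoeff_rescale_PSeries u q (q - 1))
    (constantCoeff_QSeries u) (tendsto_coeff_rescale_PSeries u) e).congr fun q => ?_
  exact coeff_mvLog_rescale (constantCoeff_PSeries u q) _ _

/-- Other roots of unity stay away from `1`: near `1` the geometric sum `(q ^ d - 1) / (q - 1)` is
close to `d ≠ 0`. -/
theorem tendsto_pow_nhdsNE_one {d : ℕ} (hd : d ≠ 0) :
    Tendsto (fun q : 𝕜 => q ^ d) (𝓝[≠] 1) (𝓝[≠] 1) := by
  refine tendsto_nhdsWithin_iff.2 ⟨?_, ?_⟩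
  · have : ContinuousAt (fun q : 𝕜 => q ^ d) 1 := by fun_prop
    simpa using this.tendsto.mono_left nhdsWithin_le_nhds
  · have hc : ContinuousAt (fun q : 𝕜 => ∑ i ∈ Finset.range d, q ^ i) 1 := by fun_prop
    have h0 : ∀ᶠ q : 𝕜 in 𝓝 1, ∑ i ∈ Finset.range d, q ^ i ≠ 0 :=
      hc.eventually_ne (by simpa using hd)
    filter_upwards [nhdsWithin_le_nhds h0, self_mem_nhdsWithin] with q h1 h2
    have h3 := mul_ne_zero h1 (sub_ne_zero.2 h2)
    rw [geom_sum_mul] at h3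
    exact sub_ne_zero.1 h3

theorem tendsto_sub_one_div_pow_sub_one {d : ℕ} (hd : d ≠ 0) :
    Tendsto (fun q : 𝕜 => (q - 1) / (q ^ d - 1)) (𝓝[≠] 1) (𝓝 (1 / (d : 𝕜))) := by
  have hc : ContinuousAt (fun q : 𝕜 => 1 / ∑ i ∈ Finset.range d, q ^ i) 1 :=
    ContinuousAt.div (by fun_prop) (by fun_prop) (by simpa using hd)
  have h1 := hc.tendsto.mono_left (nhdsWithin_le_nhds (s := {1}ᶜ))
  simp only [one_pow, Finset.sum_const, Finset.card_range, nsmul_eq_mul, mul_one] at h1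
  refine h1.congr' ?_
  filter_upwards [self_mem_nhdsWithin] with q hq
  rw [← geom_sum_mul, mul_comm, ← div_div, div_self]
  exact sub_ne_zero.2 hq

theorem tendsto_pow_mul_HFun (u : Pairs n → 𝕜) (α : Fin n → ℕ) :
    Tendsto (fun q : 𝕜 => (q - 1) ^ (∑ i, α i) * HFun α u q) (𝓝[≠] 1)
      (𝓝 ((gcdVec α : 𝕜) * MvPowerSeries.coeff (Finsupp.equivFunOnFinite.symm α)
        (mvLog (QSeries u)))) := by
  refine ((tendsto_pow_mul_coeff_mvLog_PSeries u (Finsupp.equivFunOnFinite.symm α)).const_mul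
    (gcdVec α : 𝕜)).congr fun q => ?_
  rw [HFun, Finsupp.degree_eq_sum]
  simp only [Finsupp.equivFunOnFinite_symm_apply_apply]
  ring

/-- The pole in `q ^ d - 1` has order at most `∑ α_i`, and `q - 1` is comparable to `q ^ d - 1`, so
a positive power of `q - 1` is left over. -/
theorem tendsto_pow_mul_HFun_pow (u : Pairs n → 𝕜) (α : Fin n → ℕ) {d N : ℕ} (hd : d ≠ 0)
    (hN : ∑ i, α i < N) :
    Tendsto (fun q : 𝕜 => (q - 1) ^ N * HFun α u (q ^ d)) (𝓝[≠] 1) (𝓝 0) := by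
  have h1 := (tendsto_pow_mul_HFun u α).comp (tendsto_pow_nhdsNE_one (𝕜 := 𝕜) hd)
  have h2 := (tendsto_sub_one_div_pow_sub_one (𝕜 := 𝕜) hd).pow (∑ i, α i)
  have hid : Tendsto (fun q : 𝕜 => q - 1) (𝓝[≠] 1) (𝓝 (1 - 1)) :=
    (tendsto_id.mono_left nhdsWithin_le_nhds).sub tendsto_const_nhds
  have h3 := ((hid.pow (N - ∑ i, α i)).mul h2).mul h1
  rw [sub_self, zero_pow (by omega), zero_mul, zero_mul] at h3
  refine h3.congr' ?_
  filter_upwards [(tendsto_pow_nhdsNE_one (𝕜 := 𝕜) hd).eventually self_mem_nhdsWithin] with q hq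
  have hq : (q ^ d - 1) ^ (∑ i, α i) ≠ 0 := pow_ne_zero _ (sub_ne_zero.2 hq)
  simp only [Function.comp]
  have h4 : (q - 1) ^ N = (q - 1) ^ (N - ∑ i, α i) * (q - 1) ^ (∑ i, α i) := by
    rw [← pow_add, Nat.sub_add_cancel hN.le]
  rw [h4, div_pow]
  field_simp

theorem gcdVec_ne_zero {α : Fin n → ℕ} (hα : α ≠ 0) : gcdVec α ≠ 0 := by
  intro h
  rw [gcdVec, Finset.gcd_eq_zero_iff] at h
  exact hα (funext fun i => h i (Finset.mem_univ i))

theorem tendsto_pow_mul_AFun (u : Pairs n → 𝕜) {α : Fin n → ℕ} (hα : α ≠ 0) :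
    Tendsto (fun q : 𝕜 => (q - 1) ^ ((∑ i, α i) - 1) * AFun α u q) (𝓝[≠] 1)
      (𝓝 (MvPowerSeries.coeff (Finsupp.equivFunOnFinite.symm α) (mvLog (QSeries u)))) := by
  classical
  have hg := gcdVec_ne_zero hα
  have hg' : (gcdVec α : 𝕜) ≠ 0 := Nat.cast_ne_zero.2 hg
  have hpos : 0 < ∑ i, α i := by
    obtain ⟨i, hi⟩ := Function.ne_iff.1 hα
    exact Finset.sum_pos' (fun _ _ => Nat.zero_le _) ⟨i, Finset.mem_univ i, Nat.pos_of_ne_zero hi⟩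
  set c := MvPowerSeries.coeff (Finsupp.equivFunOnFinite.symm α) (mvLog (QSeries u)) with hc
  -- For `d > 1` the sum of the `α i / d` is strictly less than that of the `α i`, so only `d = 1`
  -- survives.
  have key : ∀ d ∈ (gcdVec α).divisors, Tendsto (fun q : 𝕜 =>
      ((ArithmeticFunction.moebius d : ℤ) : 𝕜) * ((q - 1) ^ (∑ i, α i) *
        HFun (fun i => α i / d) (fun p => u p ^ d) (q ^ d))) (𝓝[≠] 1)
      (𝓝 (if d = 1 then (gcdVec α : 𝕜) * c else 0)) := by
    intro d hd
    have hd0 : d ≠ 0 := (Nat.pos_of_mem_divisors hd).ne'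
    split_ifs with h1
    · subst h1
      simpa using tendsto_pow_mul_HFun u α
    · rw [← mul_zero (((ArithmeticFunction.moebius d : ℤ) : 𝕜))]
      refine (tendsto_pow_mul_HFun_pow _ _ hd0 ?_).const_mul _
      obtain ⟨i, hi⟩ := Function.ne_iff.1 hα
      exact Finset.sum_lt_sum (fun _ _ => Nat.div_le_self _ _)
        ⟨i, Finset.mem_univ i, Nat.div_lt_self (Nat.pos_of_ne_zero hi) (by omega)⟩
  have h2 := (tendsto_finsetSum _ key).const_mul (1 / (gcdVec α : 𝕜))
  rw [Finset.sum_ite_eq' _ _ (fun _ => (gcdVec α : 𝕜) * c),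
    if_pos (Nat.one_mem_divisors.2 hg), ← mul_assoc, one_div, inv_mul_cancel₀ hg', one_mul] at h2
  refine h2.congr fun q => ?_
  have h3 : (q - 1) ^ (∑ i, α i) = (q - 1) ^ ((∑ i, α i) - 1) * (q - 1) := by
    rw [← pow_succ, Nat.sub_add_cancel hpos]
  rw [AFun, h3, Finset.mul_sum, Finset.mul_sum, Finset.mul_sum]
  refine Finset.sum_congr rfl fun d _ => ?_
  ring

end Limit

/-! ### Weighted sums over graphs; a graph on `S` is a graph on `V` with all edges inside `S`. -/

section GraphSums

variable {V : Type*}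

/-- All edges of `G` have their ends in `S`. -/
def SupportedOn (G : SimpleGraph V) (S : Finset V) : Prop := ∀ ⦃a b⦄, G.Adj a b → a ∈ S

/-- Any two elements of `S` are joined by a walk in `G`. -/
def ConnectedOn (G : SimpleGraph V) (S : Finset V) : Prop := ∀ a ∈ S, ∀ b ∈ S, G.Reachable a b

/-- The graph on `V` with those edges of `G` that have both ends in `A`. -/
def restrict (G : SimpleGraph V) (A : Finset V) : SimpleGraph V where
  Adj a b := G.Adj a b ∧ a ∈ A ∧ b ∈ A
  symm := ⟨fun _ _ h => ⟨h.1.symm, h.2.2, h.2.1⟩⟩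
  loopless := ⟨fun _ h => h.1.ne rfl⟩

theorem supportedOn_restrict (G : SimpleGraph V) (A : Finset V) :
    SupportedOn (restrict G A) A := fun _ _ h => h.2.1

theorem reachable_restrict {G : SimpleGraph V} {A : Finset V}
    (hA : ∀ ⦃a b⦄, a ∈ A → G.Adj a b → b ∈ A) {r v : V} (hr : r ∈ A) (h : G.Reachable r v) :
    v ∈ A ∧ (restrict G A).Reachable r v := by
  obtain ⟨w⟩ := h
  induction w with
  | nil => exact ⟨hr, .refl _⟩
  | cons hadj _ ih =>
    have hb := hA hr hadj
    obtain ⟨h1, h2⟩ := ih hb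
    have h3 : (restrict G A).Adj _ _ := ⟨hadj, hr, hb⟩
    exact ⟨h1, h3.reachable.trans h2⟩

theorem restrict_sup_left {G H : SimpleGraph V} {A B : Finset V} (hG : SupportedOn G A)
    (hH : SupportedOn H B) (hAB : Disjoint A B) : restrict (G ⊔ H) A = G := by
  ext a b
  constructor
  · rintro ⟨h | h, ha, -⟩
    · exact h
    · exact absurd (hH h) (Finset.disjoint_left.1 hAB ha)
  · exact fun h => ⟨Or.inl h, hG h, hG h.symm⟩

variable [Fintype V] {R : Type*} [CommRing R]

open Classical in
/-- The product of the weights of the edges of `G`. -/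
noncomputable def graphWeight (x : Sym2 V → R) (G : SimpleGraph V) : R :=
  ∏ e with e ∈ G.edgeSet, x e

open Classical in
/-- The sum of the weights of all graphs on `S`. -/
noncomputable def graphSum (x : Sym2 V → R) (S : Finset V) : R :=
  ∑ G : SimpleGraph V with SupportedOn G S, graphWeight x G

open Classical in
/-- The sum of the weights of all connected graphs on `S`. -/
noncomputable def connGraphSum (x : Sym2 V → R) (S : Finset V) : R :=
  ∑ G : SimpleGraph V with SupportedOn G S ∧ ConnectedOn G S, graphWeight x G

theorem graphWeight_sup (x : Sym2 V → R) {G H : SimpleGraph V} {A B : Finset V}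
    (hG : SupportedOn G A) (hH : SupportedOn H B) (hAB : Disjoint A B) :
    graphWeight x (G ⊔ H) = graphWeight x G * graphWeight x H := by
  classical
  unfold graphWeight
  rw [← Finset.prod_union]
  · congr 1
    ext e
    simp [SimpleGraph.edgeSet_sup]
  · rw [Finset.disjoint_left]
    intro e
    induction e with
    | _ a b =>
      simp only [Finset.mem_filter, Finset.mem_univ, true_and, SimpleGraph.mem_edgeSet]
      exact fun h1 h2 => Finset.disjoint_left.1 hAB (hG h1) (hH h2)

/-- Split off the component `insert r T` of the root `r`: a graph is the union of a connected graph
on it and an arbitrary graph on the remaining vertices. -/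
theorem graphSum_insert [DecidableEq V] (x : Sym2 V → R) {r : V} {S : Finset V} (hr : r ∉ S) :
    graphSum x (insert r S) =
      ∑ T ∈ S.powerset, connGraphSum x (insert r T) * graphSum x (S \ T) := by
  classical
  rw [graphSum, ← Finset.sum_fiberwise_of_maps_to (t := S.powerset)
    (g := fun G : SimpleGraph V => S.filter fun v => G.Reachable r v)
    fun G _ => Finset.mem_powerset.2 (Finset.filter_subset _ _)]
  refine Finset.sum_congr rfl fun T hT => ?_
  have hTS := Finset.mem_powerset.1 hT
  have hdisj : Disjoint (insert r T) (S \ T) := by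
    rw [Finset.disjoint_left]
    intro a ha hb
    rw [Finset.mem_sdiff] at hb
    rcases Finset.mem_insert.1 ha with rfl | ha
    · exact hr hb.1
    · exact hb.2 ha
  have hback : ∀ G : SimpleGraph V, SupportedOn G (insert r S) →
      S.filter (fun v => G.Reachable r v) = T →
      ∀ ⦃a b⦄, a ∈ insert r T → G.Adj a b → b ∈ insert r T := by
    intro G hG hGT a b ha hab
    have h1 : G.Reachable r a := by
      rcases Finset.mem_insert.1 ha with rfl | ha
      · exact .refl _
      · rw [← hGT] at ha
        exact (Finset.mem_filter.1 ha).2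
    rcases Finset.mem_insert.1 (hG hab.symm) with rfl | hb
    · exact Finset.mem_insert_self _ _
    · refine Finset.mem_insert_of_mem ?_
      rw [← hGT]
      exact Finset.mem_filter.2 ⟨hb, h1.trans hab.reachable⟩
  have hsup : ∀ G : SimpleGraph V, SupportedOn G (insert r S) →
      S.filter (fun v => G.Reachable r v) = T →
      restrict G (insert r T) ⊔ restrict G (S \ T) = G := by
    intro G hG hGT
    have hcl := hback G hG hGT
    ext a b
    constructor
    · rintro (h | h) <;> exact h.1
    · intro h
      by_cases ha : a ∈ insert r T
      · exact Or.inl ⟨h, ha, hcl ha h⟩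
      · have hb : b ∉ insert r T := fun hb => ha (hcl hb h.symm)
        have hmem : ∀ v, v ∈ insert r S → v ∉ insert r T → v ∈ S \ T := by
          intro v hv hv'
          rw [Finset.mem_insert] at hv hv'
          rw [Finset.mem_sdiff]
          tauto
        exact Or.inr ⟨h, hmem a (hG h) ha, hmem b (hG h.symm) hb⟩
  rw [connGraphSum, graphSum, Finset.sum_mul_sum, ← Finset.sum_product']
  refine Finset.sum_nbij' (fun G => (restrict G (insert r T), restrict G (S \ T)))
    (fun p => p.1 ⊔ p.2) ?_ ?_ ?_ ?_ ?_
  · intro G hG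
    simp only [Finset.mem_filter, Finset.mem_univ, true_and] at hG
    simp only [Finset.mem_product, Finset.mem_filter, Finset.mem_univ, true_and]
    refine ⟨⟨supportedOn_restrict _ _, ?_⟩, supportedOn_restrict _ _⟩
    have h1 : ∀ a ∈ insert r T, (restrict G (insert r T)).Reachable r a := by
      intro a ha
      refine (reachable_restrict (hback G hG.1 hG.2) (Finset.mem_insert_self _ _) ?_).2
      rcases Finset.mem_insert.1 ha with rfl | ha
      · exact .refl _
      · rw [← hG.2] at ha
        exact (Finset.mem_filter.1 ha).2
    exact fun a ha b hb => (h1 a ha).symm.trans (h1 b hb)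
  · rintro ⟨G, H⟩ hGH
    simp only [Finset.mem_product, Finset.mem_filter, Finset.mem_univ, true_and] at hGH
    obtain ⟨⟨hG, hGc⟩, hH⟩ := hGH
    simp only [Finset.mem_filter, Finset.mem_univ, true_and]
    constructor
    · rintro a b (h | h)
      · exact Finset.insert_subset_insert r hTS (hG h)
      · exact Finset.mem_insert_of_mem (Finset.mem_sdiff.1 (hH h)).1
    · ext v
      simp only [Finset.mem_filter]
      constructor
      · rintro ⟨hv, h⟩
        have hcl : ∀ ⦃a b⦄, a ∈ insert r T → (G ⊔ H).Adj a b → b ∈ insert r T := by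
          rintro a b ha (h | h)
          · exact hG h.symm
          · exact absurd (hH h) (Finset.disjoint_left.1 hdisj ha)
        rcases Finset.mem_insert.1
          (reachable_restrict hcl (Finset.mem_insert_self _ _) h).1 with rfl | h
        · exact absurd hv hr
        · exact h
      · intro hv
        exact ⟨hTS hv, (hGc r (Finset.mem_insert_self _ _) v (Finset.mem_insert_of_mem hv)).mono
          le_sup_left⟩
  · intro G hG
    simp only [Finset.mem_filter, Finset.mem_univ, true_and] at hG
    exact hsup G hG.1 hG.2
  · rintro ⟨G, H⟩ hGH
    simp only [Finset.mem_product, Finset.mem_filter, Finset.mem_univ, true_and] at hGH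
    obtain ⟨⟨hG, hGc⟩, hH⟩ := hGH
    refine Prod.ext (restrict_sup_left hG hH hdisj) ?_
    simp only
    rw [sup_comm]
    exact restrict_sup_left hH hG hdisj.symm
  · intro G hG
    simp only [Finset.mem_filter, Finset.mem_univ, true_and] at hG
    rw [← graphWeight_sup x (supportedOn_restrict _ _) (supportedOn_restrict _ _) hdisj,
      hsup G hG.1 hG.2]

/-- A graph on `S` is a subset of the non-loop pairs in `S`, and expanding the product runs over
these subsets. -/
theorem graphSum_eq_prod [DecidableEq V] (x : Sym2 V → R) (S : Finset V) :
    graphSum x S = ∏ e ∈ S.offDiag.image Sym2.mk.uncurry, (1 + x e) := by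
  classical
  rw [Finset.prod_one_add, graphSum]
  have hmem : ∀ a b : V, s(a, b) ∈ S.offDiag.image Sym2.mk.uncurry ↔ a ∈ S ∧ b ∈ S ∧ a ≠ b := by
    intro a b
    simp only [Finset.mem_image, Finset.mem_offDiag, Prod.exists, Function.uncurry, Sym2.eq_iff]
    constructor
    · rintro ⟨a', b', ⟨h1, h2, h3⟩, ⟨rfl, rfl⟩ | ⟨rfl, rfl⟩⟩
      · exact ⟨h1, h2, h3⟩
      · exact ⟨h2, h1, h3.symm⟩
    · exact fun h => ⟨a, b, h, Or.inl ⟨rfl, rfl⟩⟩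
  refine Finset.sum_nbij' (fun G => Finset.univ.filter fun e => e ∈ G.edgeSet)
    (fun t => SimpleGraph.fromEdgeSet (t : Set (Sym2 V))) ?_ ?_ ?_ ?_ ?_
  · intro G hG
    rw [Finset.mem_filter] at hG
    rw [Finset.mem_powerset]
    intro e
    induction e with
    | _ a b =>
      intro h
      have h : G.Adj a b := by simpa using h
      exact (hmem a b).2 ⟨hG.2 h, hG.2 h.symm, h.ne⟩
  · intro t ht
    rw [Finset.mem_powerset] at ht
    simp only [Finset.mem_filter, Finset.mem_univ, true_and]
    intro a b h
    have h1 : s(a, b) ∈ t := Finset.mem_coe.1 ((SimpleGraph.fromEdgeSet_adj _).1 h).1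
    exact ((hmem a b).1 (ht h1)).1
  · intro G _
    simp
  · intro t ht
    rw [Finset.mem_powerset] at ht
    ext e
    induction e with
    | _ a b =>
      simp only [Finset.mem_filter, Finset.mem_univ, true_and, SimpleGraph.mem_edgeSet,
        SimpleGraph.fromEdgeSet_adj, Finset.mem_coe]
      exact ⟨fun h => h.1, fun h => ⟨h, ((hmem a b).1 (ht h)).2.2⟩⟩
  · intro G _
    rfl

end GraphSums

/-! ### Coloured vertex sets and the exponential formula. -/

section ColourCounts

variable {V : Type*} {n : ℕ}

/-- The number of elements of each colour in `S`. -/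
noncomputable def colourCount (c : V → Fin n) (S : Finset V) : Fin n →₀ ℕ :=
  Finsupp.equivFunOnFinite.symm fun i => (S.filter fun v => c v = i).card

theorem colourCount_apply (c : V → Fin n) (S : Finset V) (i : Fin n) :
    colourCount c S i = (S.filter fun v => c v = i).card := rfl

variable [DecidableEq V]

theorem colourCount_insert (c : V → Fin n) {r : V} {S : Finset V} (hr : r ∉ S) :
    colourCount c (insert r S) = colourCount c S + Finsupp.single (c r) 1 := by
  ext i
  rw [Finsupp.add_apply, colourCount_apply, colourCount_apply, Finset.filter_insert]
  by_cases h : c r = i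
  · subst h
    rw [if_pos rfl, Finset.card_insert_of_notMem (by simp [hr])]
    simp
  · simp [h]

theorem colourCount_union (c : V → Fin n) {S T : Finset V} (h : Disjoint S T) :
    colourCount c (S ∪ T) = colourCount c S + colourCount c T := by
  ext i
  rw [Finsupp.add_apply, colourCount_apply, colourCount_apply, colourCount_apply,
    Finset.filter_union, Finset.card_union_of_disjoint (Finset.disjoint_filter_filter h)]

theorem card_filter_colourCount_eq (c : V → Fin n) (S : Finset V) (a : Fin n →₀ ℕ) :
    (S.powerset.filter fun T => colourCount c T = a).card =
      ∏ i, (colourCount c S i).choose (a i) := by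
  simp_rw [colourCount_apply, ← Finset.card_powersetCard]
  rw [← Fintype.card_piFinset]
  have hfib : ∀ g ∈ Fintype.piFinset fun i => Finset.powersetCard (a i) {v ∈ S | c v = i},
      ∀ i, (Finset.univ.biUnion g).filter (fun v => c v = i) = g i := by
    intro g hg i
    rw [Fintype.mem_piFinset] at hg
    have hg' : ∀ j, ∀ v ∈ g j, c v = j := fun j v hv =>
      (Finset.mem_filter.1 ((Finset.mem_powersetCard.1 (hg j)).1 hv)).2
    ext v
    simp only [Finset.mem_filter, Finset.mem_biUnion, Finset.mem_univ, true_and]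
    constructor
    · rintro ⟨⟨j, hj⟩, h⟩
      rwa [← h, hg' j v hj]
    · exact fun h => ⟨⟨i, h⟩, hg' i v h⟩
  refine Finset.card_nbij' (fun T i => T.filter fun v => c v = i)
    (fun g => Finset.univ.biUnion g) ?_ ?_ ?_ ?_
  · intro T hT
    simp only [Finset.coe_filter, Set.mem_ofPred_eq, Finset.mem_powerset] at hT
    rw [Finset.mem_coe, Fintype.mem_piFinset]
    intro i
    rw [Finset.mem_powersetCard]
    exact ⟨Finset.filter_subset_filter _ hT.1, by rw [← hT.2, colourCount_apply]⟩
  · intro g hg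
    have hf := hfib g (Finset.mem_coe.1 hg)
    rw [Finset.mem_coe, Fintype.mem_piFinset] at hg
    simp only [Finset.coe_filter, Set.mem_ofPred_eq, Finset.mem_powerset]
    constructor
    · refine Finset.biUnion_subset.2 fun i _ => ?_
      exact (Finset.mem_powersetCard.1 (hg i)).1.trans (Finset.filter_subset _ _)
    · ext i
      rw [colourCount_apply, hf i, (Finset.mem_powersetCard.1 (hg i)).2]
  · intro T _
    ext v
    simp
  · intro g hg
    exact funext fun i => hfib g (Finset.mem_coe.1 hg) i

/-- `∏_i a_i!`. -/
def multiFactorial (a : Fin n →₀ ℕ) : ℕ := ∏ i, (a i).factorial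

/-- This is the product rule for exponential generating functions: the number of `T` with given
colour counts is a product of binomial coefficients, which cancels against the factorials. -/
theorem sum_powerset_colourCount {K : Type*} [Field K] [CharZero K] (c : V → Fin n) (S : Finset V)
    (f g : (Fin n →₀ ℕ) → K) :
    ∑ T ∈ S.powerset, (multiFactorial (colourCount c T) * f (colourCount c T)) *
        (multiFactorial (colourCount c (S \ T)) * g (colourCount c (S \ T))) =
      multiFactorial (colourCount c S) *
        ∑ p ∈ Finset.HasAntidiagonal.antidiagonal (colourCount c S), f p.1 * g p.2 := by
  have hadd : ∀ T ∈ S.powerset, colourCount c T + colourCount c (S \ T) = colourCount c S := by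
    intro T hT
    rw [← colourCount_union c Finset.disjoint_sdiff,
      Finset.union_sdiff_of_subset (Finset.mem_powerset.1 hT)]
  rw [← Finset.sum_fiberwise_of_maps_to (t := Finset.HasAntidiagonal.antidiagonal (colourCount c S))
    (g := fun T => (colourCount c T, colourCount c (S \ T)))
    fun T hT => Finset.HasAntidiagonal.mem_antidiagonal.2 (hadd T hT), Finset.mul_sum]
  refine Finset.sum_congr rfl fun p hp => ?_
  have hp : p.1 + p.2 = colourCount c S := Finset.HasAntidiagonal.mem_antidiagonal.1 hp
  have hfilter : (S.powerset.filter fun T => (colourCount c T, colourCount c (S \ T)) = p) =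
      S.powerset.filter fun T => colourCount c T = p.1 := by
    refine Finset.filter_congr fun T hT => ?_
    constructor
    · rintro rfl
      rfl
    · intro h
      refine Prod.ext h ?_
      have := hadd T hT
      rw [← hp, h] at this
      exact add_left_cancel this
  rw [Finset.sum_congr rfl (g := fun _ => (multiFactorial p.1 * f p.1) *
    (multiFactorial p.2 * g p.2)), Finset.sum_const, hfilter, card_filter_colourCount_eq,
    nsmul_eq_mul]
  · have h1 : (∏ i, (colourCount c S i).choose (p.1 i)) * multiFactorial p.1 * multiFactorial p.2 =
        multiFactorial (colourCount c S) := by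
      unfold multiFactorial
      rw [← Finset.prod_mul_distrib, ← Finset.prod_mul_distrib]
      refine Finset.prod_congr rfl fun i _ => ?_
      rw [← hp, Finsupp.add_apply, Nat.choose_symm_add]
      exact Nat.add_choose_mul_factorial_mul_factorial _ _
    rw [← h1]
    push_cast
    ring
  · intro T hT
    have hT := (Finset.mem_filter.1 hT).2
    rw [← hT]

theorem multiFactorial_add_single (a : Fin n →₀ ℕ) (i : Fin n) :
    multiFactorial (a + Finsupp.single i 1) = (a i + 1) * multiFactorial a := by
  unfold multiFactorial
  rw [← Finset.mul_prod_erase _ _ (Finset.mem_univ i),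
    ← Finset.mul_prod_erase _ (fun j => (a j).factorial) (Finset.mem_univ i), ← mul_assoc]
  congr 1
  · simp [Nat.factorial_succ]
  · refine Finset.prod_congr rfl fun j hj => ?_
    have := Finset.ne_of_mem_erase hj
    simp [this.symm]

/-- The exponential formula, for functions on the finite subsets of a coloured set. -/
theorem eq_coeff_mvLog {K : Type*} [Field K] [CharZero K] (c : V → Fin n)
    {F : MvPowerSeries (Fin n) K} (hF : MvPowerSeries.constantCoeff F = 1) {all conn : Finset V → K}
    (hall : ∀ S, all S =
      multiFactorial (colourCount c S) * MvPowerSeries.coeff (colourCount c S) F)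
    (hrec : ∀ r S, r ∉ S → all (insert r S) =
      ∑ T ∈ S.powerset, conn (insert r T) * all (S \ T)) :
    ∀ S : Finset V, S.Nonempty → conn S =
      multiFactorial (colourCount c S) * MvPowerSeries.coeff (colourCount c S) (mvLog F) := by
  intro S
  induction S using Finset.strongInduction with
  | H S ih =>
    rintro ⟨r, hrS⟩
    obtain ⟨S, hr, rfl⟩ : ∃ S', r ∉ S' ∧ insert r S' = S :=
      ⟨S.erase r, Finset.notMem_erase _ _, Finset.insert_erase hrS⟩
    set h : Finset V → K := fun T =>
      multiFactorial (colourCount c T) * MvPowerSeries.coeff (colourCount c T) (mvLog F) with hh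
    -- The candidate `h` satisfies the same rooted recursion as `conn`: it is `F * ∂(log F) = ∂F`,
    -- differentiated in the variable of the colour of `r`.
    have h1 : all (insert r S) = ∑ T ∈ S.powerset, h (insert r T) * all (S \ T) := by
      have h2 := sum_powerset_colourCount c S
        (fun a => MvPowerSeries.coeff a (MvPowerSeries.pderiv K (c r) (mvLog F)))
        (fun a => MvPowerSeries.coeff a F)
      rw [← MvPowerSeries.coeff_mul, mul_comm (MvPowerSeries.pderiv K (c r) (mvLog F)),
        mul_pderiv_mvLog hF, MvPowerSeries.coeff_pderiv] at h2
      rw [hall, colourCount_insert c hr, multiFactorial_add_single]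
      refine Eq.trans (by push_cast; ring) (h2.symm.trans ?_)
      refine Finset.sum_congr rfl fun T hT => ?_
      have hrT : r ∉ T := fun h => hr (Finset.mem_powerset.1 hT h)
      rw [hh, hall]
      simp only
      rw [colourCount_insert c hrT, multiFactorial_add_single, MvPowerSeries.coeff_pderiv]
      push_cast
      ring
    rw [hrec r S hr] at h1
    have hmem : S ∈ S.powerset := Finset.mem_powerset_self S
    -- In both recursions the terms with `T ≠ S` agree by induction; the term `T = S` has
    -- coefficient `all ∅ = 1`, so cancelling gives the claim.
    rw [← Finset.add_sum_erase _ _ hmem, ← Finset.add_sum_erase _ (fun T => _ * _) hmem,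
      Finset.sum_congr rfl (g := fun T => h (insert r T) * all (S \ T)) ?_] at h1
    · have h0 : all (S \ S) = 1 := by
        rw [hall, Finset.sdiff_self]
        have : colourCount c (∅ : Finset V) = 0 := by ext; simp [colourCount_apply]
        rw [this, MvPowerSeries.coeff_zero_eq_constantCoeff_apply, hF]
        simp [multiFactorial]
      have h2 := add_right_cancel h1
      rwa [h0, mul_one, mul_one] at h2
    · intro T hT
      have hTS := Finset.mem_powerset.1 (Finset.mem_of_mem_erase hT)
      have hss : T ⊂ S := lt_of_le_of_ne hTS (Finset.ne_of_mem_erase hT)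
      rw [ih (insert r T) ?_ (Finset.insert_nonempty _ _)]
      refine (Finset.insert_subset_insert r hTS).ssubset_of_ne fun h => hss.ne ?_
      rw [← Finset.erase_insert (fun h => hr (hTS h) : r ∉ T), h, Finset.erase_insert hr]

end ColourCounts

/-! ### Edge and vertex weights turning `QSeries` into a sum over graphs. -/

section Weights

variable {V : Type*} {n : ℕ} {R : Type*} [CommRing R]

/-- The colours of the ends of an edge. -/
def edgeColour (c : V → Fin n) (e : Sym2 V) : Pairs n := Sym2.sortEquiv (e.map c)

theorem edgeColour_eq_iff (c : V → Fin n) (e : Sym2 V) (p : Pairs n) :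
    edgeColour c e = p ↔ e.map c = s(p.1.1, p.1.2) := by
  rw [edgeColour, ← Equiv.eq_symm_apply]
  rfl

/-- The weight of an edge of colour `p`. -/
def pairWeight (u : Pairs n → R) (p : Pairs n) : R :=
  if p.1.1 = p.1.2 then u p ^ 2 - 1 else u p - 1

/-- The value `u_ij` for `i ≤ j`, and `1` otherwise. -/
def extendPairs (u : Pairs n → R) (i j : Fin n) : R := if h : i ≤ j then u ⟨(i, j), h⟩ else 1

/-- An edge stands for two ordered pairs. Within a colour both contribute `u_ii`, hence the square;
between different colours only the increasing order contributes. -/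
theorem one_add_pairWeight (u : Pairs n → R) (c : V → Fin n) (a b : V) :
    1 + pairWeight u (edgeColour c s(a, b)) =
      extendPairs u (c a) (c b) * extendPairs u (c b) (c a) := by
  have key : ∀ a b, c a ≤ c b → 1 + pairWeight u (edgeColour c s(a, b)) =
      extendPairs u (c a) (c b) * extendPairs u (c b) (c a) := by
    intro a b hab
    have h1 : edgeColour c s(a, b) = ⟨(c a, c b), hab⟩ := by
      rw [edgeColour_eq_iff]
      rfl
    rw [h1, pairWeight]
    rcases hab.eq_or_lt with h | h
    · simp only [extendPairs, h, le_refl, dif_pos, if_pos]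
      ring
    · simp only [extendPairs, hab, h.not_ge, h.ne, dif_pos, dif_neg, if_false, not_false_eq_true]
      ring
  rcases le_total (c a) (c b) with h | h
  · exact key a b h
  · rw [Sym2.eq_swap, key b a h, mul_comm]

theorem prod_offDiag_eq [DecidableEq V] (S : Finset V) (g : V → V → R) (w : Sym2 V → R)
    (hw : ∀ a b, w s(a, b) = g a b * g b a) :
    ∏ p ∈ S.offDiag, g p.1 p.2 = ∏ e ∈ S.offDiag.image Sym2.mk.uncurry, w e := by
  rw [← Finset.prod_fiberwise_of_maps_to (g := Sym2.mk.uncurry)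
    fun p hp => Finset.mem_image_of_mem _ hp]
  refine Finset.prod_congr rfl fun e he => ?_
  obtain ⟨⟨a, b⟩, hab, rfl⟩ := Finset.mem_image.1 he
  rw [Finset.mem_offDiag] at hab
  have h1 : S.offDiag.filter (fun p => Sym2.mk.uncurry p = Sym2.mk.uncurry (a, b)) =
      {(a, b), (b, a)} := by
    ext ⟨a', b'⟩
    simp only [Finset.mem_filter, Finset.mem_offDiag, Function.uncurry, Sym2.eq_iff,
      Finset.mem_insert, Finset.mem_singleton, Prod.mk.injEq]
    constructor
    · exact fun h => h.2
    · rintro (⟨rfl, rfl⟩ | ⟨rfl, rfl⟩)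
      · exact ⟨hab, Or.inl ⟨rfl, rfl⟩⟩
      · exact ⟨⟨hab.2.1, hab.1, hab.2.2.symm⟩, Or.inr ⟨rfl, rfl⟩⟩
  rw [h1, Finset.prod_pair]
  · exact (hw a b).symm
  · intro h
    exact hab.2.2 (Prod.mk.inj h).1

theorem extendPairs_eq_prod (u : Pairs n → R) (i j : Fin n) :
    extendPairs u i j = ∏ p : Pairs n, if i = p.1.1 ∧ j = p.1.2 then u p else 1 := by
  unfold extendPairs
  split_ifs with h
  · rw [Fintype.prod_eq_single ⟨(i, j), h⟩]
    · simp
    · intro p hp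
      rw [if_neg]
      rintro ⟨rfl, rfl⟩
      exact hp rfl
  · rw [Finset.prod_eq_one]
    intro p _
    rw [if_neg]
    rintro ⟨rfl, rfl⟩
    exact h p.2

theorem prod_extendPairs (u : Pairs n → R) (c : V → Fin n) (S : Finset V) :
    ∏ q ∈ S ×ˢ S, extendPairs u (c q.1) (c q.2) =
      ∏ p : Pairs n, u p ^ (colourCount c S p.1.1 * colourCount c S p.1.2) := by
  simp_rw [extendPairs_eq_prod]
  rw [Finset.prod_comm]
  refine Finset.prod_congr rfl fun p _ => ?_
  rw [← Finset.prod_filter, Finset.prod_const, Finset.filter_product (fun a => c a = p.1.1)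
    (fun b => c b = p.1.2), Finset.card_product]
  rfl

variable [Fintype V]

/-- The right side is a product over `S ×ˢ S`: its diagonal gives the vertex weights, its
off-diagonal part the edge factors. -/
theorem prod_mul_graphSum (u : Pairs n → R) (c : V → Fin n) (S : Finset V) :
    (∏ v ∈ S, u (diag (c v))) * graphSum (fun e => pairWeight u (edgeColour c e)) S =
      ∏ p : Pairs n, u p ^ (colourCount c S p.1.1 * colourCount c S p.1.2) := by
  classical
  rw [graphSum_eq_prod, ← prod_offDiag_eq S (fun a b => extendPairs u (c a) (c b))
    (fun e => 1 + pairWeight u (edgeColour c e)) fun a b => one_add_pairWeight u c a b,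
    ← prod_extendPairs, ← Finset.diag_union_offDiag S,
    Finset.prod_union (Finset.disjoint_diag_offDiag S), Finset.prod_diag]
  congr 1
  refine Finset.prod_congr rfl fun v _ => ?_
  simp [extendPairs, diag]

/-- The weighted sum over all connected graphs on `V`: an edge has the weight `u_ij - 1`, with the
square of `u_ij` in place of `u_ij` for `i = j`, and a vertex has the weight `u_ii`. -/
noncomputable def connSum (c : V → Fin n) (u : Pairs n → R) : R :=
  (∏ v, u (diag (c v))) * connGraphSum (fun e => pairWeight u (edgeColour c e)) Finset.univ

/-- The vertex weights are multiplicative over disjoint sets, so they preserve the recursion of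
`graphSum_insert`. -/
theorem connSum_eq_coeff_mvLog {K : Type*} [Field K] [CharZero K] [Nonempty V] (c : V → Fin n)
    (u : Pairs n → K) :
    connSum c u = multiFactorial (colourCount c Finset.univ) *
      MvPowerSeries.coeff (colourCount c Finset.univ) (mvLog (QSeries u)) := by
  classical
  refine eq_coeff_mvLog c (constantCoeff_QSeries u)
    (all := fun S => (∏ v ∈ S, u (diag (c v))) *
      graphSum (fun e => pairWeight u (edgeColour c e)) S)
    (conn := fun S => (∏ v ∈ S, u (diag (c v))) *
      connGraphSum (fun e => pairWeight u (edgeColour c e)) S) ?_ ?_ _ Finset.univ_nonempty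
  · intro S
    rw [prod_mul_graphSum]
    change _ = _ * QSeries u (colourCount c S)
    have h : ((multiFactorial (colourCount c S) : ℕ) : K) ≠ 0 :=
      Nat.cast_ne_zero.2 (Finset.prod_ne_zero_iff.2 fun i _ => Nat.factorial_ne_zero _)
    rw [QSeries]
    exact (mul_div_cancel₀ _ h).symm
  · intro r S hr
    rw [graphSum_insert _ hr, Finset.mul_sum]
    refine Finset.sum_congr rfl fun T hT => ?_
    have hTS := Finset.mem_powerset.1 hT
    rw [Finset.prod_insert hr, Finset.prod_insert fun h => hr (hTS h),
      ← Finset.prod_sdiff hTS]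
    ring

/-- This lets one generic polynomial be both evaluated at a point and expanded around `u = 1`. -/
theorem map_connSum {R' : Type*} [CommRing R'] (f : R →+* R') (c : V → Fin n) (u : Pairs n → R) :
    f (connSum c u) = connSum c (fun p => f (u p)) := by
  have h : ∀ p, f (pairWeight u p) = pairWeight (fun p => f (u p)) p := by
    intro p
    unfold pairWeight
    split_ifs <;> simp
  simp [connSum, connGraphSum, graphWeight, map_prod, map_sum, h]

theorem sum_ncard_edges [DecidableEq V] (c : V → Fin n) (G : SimpleGraph V) :
    ∑ p : Pairs n, {e ∈ G.edgeSet | e.map c = s(p.1.1, p.1.2)}.ncard = Nat.card G.edgeSet := by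
  classical
  rw [Nat.card_coe_set_eq, Set.ncard_eq_toFinset_card', Finset.card_eq_sum_card_fiberwise
    (f := edgeColour c) (t := Finset.univ) fun _ _ => Finset.mem_coe.2 (Finset.mem_univ _)]
  refine Finset.sum_congr rfl fun p _ => ?_
  rw [Set.ncard_eq_toFinset_card']
  congr 1
  ext e
  simp [edgeColour_eq_iff]

theorem graphWeight_edgeColour (c : V → Fin n) (w : Pairs n → R) (G : SimpleGraph V) :
    graphWeight (fun e => w (edgeColour c e)) G =
      ∏ p : Pairs n, w p ^ {e ∈ G.edgeSet | e.map c = s(p.1.1, p.1.2)}.ncard := by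
  classical
  rw [graphWeight, ← Finset.prod_fiberwise' _ (edgeColour c) w]
  refine Finset.prod_congr rfl fun p _ => ?_
  rw [Finset.prod_const, Set.ncard_eq_toFinset_card']
  congr 2
  ext e
  simp [edgeColour_eq_iff]

theorem supportedOn_univ_and_connectedOn_univ [Nonempty V] (G : SimpleGraph V) :
    (SupportedOn G Finset.univ ∧ ConnectedOn G Finset.univ) ↔ G.Connected := by
  simp [SupportedOn, ConnectedOn, SimpleGraph.connected_iff, SimpleGraph.Preconnected,
    ‹Nonempty V›]

end Weights

/-! ### Coefficients of products of one-variable polynomials. -/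

section Coefficients

theorem coeff_prod_aeval_X {σ K : Type*} [Fintype σ] [CommRing K] (f : σ → Polynomial K)
    (k : σ →₀ ℕ) :
    MvPolynomial.coeff k (∏ p, Polynomial.aeval (MvPolynomial.X p : MvPolynomial σ K) (f p)) =
      ∏ p, (f p).coeff (k p) := by
  classical
  -- A common bound above all degrees and all `k p`, so that one range serves every factor and
  -- contains the wanted exponent.
  set N := (∑ p, (f p).natDegree) + (∑ p, k p) + 1 with hN
  have hle : ∀ p, (f p).natDegree < N ∧ k p < N := by
    intro p
    have h1 := Finset.single_le_sum (f := fun p => (f p).natDegree) (fun _ _ => Nat.zero_le _)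
      (Finset.mem_univ p)
    have h2 := Finset.single_le_sum (f := fun p => k p) (fun _ _ => Nat.zero_le _)
      (Finset.mem_univ p)
    omega
  have h1 : ∀ p, Polynomial.aeval (MvPolynomial.X p : MvPolynomial σ K) (f p) =
      ∑ m ∈ Finset.range N, MvPolynomial.monomial (Finsupp.single p m) ((f p).coeff m) := by
    intro p
    rw [Polynomial.aeval_eq_sum_range' (hle p).1]
    refine Finset.sum_congr rfl fun m _ => ?_
    rw [MvPolynomial.X_pow_eq_monomial, MvPolynomial.smul_monomial, smul_eq_mul, mul_one]
  simp_rw [h1]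
  rw [Finset.prod_univ_sum, MvPolynomial.coeff_sum]
  have h2 : ∀ m : σ → ℕ, ∏ p, MvPolynomial.monomial (Finsupp.single p (m p)) ((f p).coeff (m p)) =
      MvPolynomial.monomial (Finsupp.equivFunOnFinite.symm m) (∏ p, (f p).coeff (m p)) := by
    intro m
    rw [← MvPolynomial.monomial_sum_prod]
    refine congrArg (fun d => MvPolynomial.monomial d _) (Finsupp.ext fun p => ?_)
    simp [Finsupp.finsetSum_apply, Finsupp.single_apply]
  simp only [h2, MvPolynomial.coeff_monomial]
  rw [Finset.sum_eq_single (fun p => k p)]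
  · rw [if_pos]
    exact Finsupp.equivFunOnFinite.symm_apply_apply k
  · intro m _ hm
    rw [if_neg]
    rintro rfl
    exact hm rfl
  · intro h
    exact absurd (Fintype.mem_piFinset.2 fun p => Finset.mem_range.2 (hle p).2) h

theorem coeff_X_mul_X_add_two_pow {K : Type*} [Field K] (m a k : ℕ) :
    ((Polynomial.X * (Polynomial.X + 2) : Polynomial K) ^ m * (Polynomial.X + 1) ^ a).coeff k =
      if m ≤ k then ∑ j ∈ Finset.range (k - m + 1),
        (m.choose j * a.choose (k - m - j) * 2 ^ (m - j) : K) else 0 := by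
  rw [mul_pow, mul_assoc, Polynomial.coeff_X_pow_mul']
  refine if_congr Iff.rfl ?_ rfl
  rw [Polynomial.coeff_mul, Finset.Nat.sum_antidiagonal_eq_sum_range_succ_mk]
  refine Finset.sum_congr rfl fun j _ => ?_
  have : (2 : Polynomial K) = Polynomial.C 2 := rfl
  rw [this, Polynomial.coeff_X_add_C_pow, Polynomial.coeff_X_add_one_pow]
  ring

end Coefficients

/-! ### Coefficients at `u = 1` and connected graph counts. -/

section Main

variable {n : ℕ}

theorem diag_injective : Function.Injective (diag (n := n)) := fun _ _ h =>
  congrArg (fun p : Pairs n => p.1.1) h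

theorem eq_diag {p : Pairs n} (h : p.1.1 = p.1.2) : p = diag p.1.1 :=
  Subtype.ext (Prod.ext rfl h.symm)

theorem colourCount_univ_sigma (α : Fin n → ℕ) :
    colourCount (Sigma.fst : ((i : Fin n) × Fin (α i)) → Fin n) Finset.univ =
      Finsupp.equivFunOnFinite.symm α := by
  ext i
  rw [colourCount_apply]
  have h : (Finset.univ.filter fun v : (i : Fin n) × Fin (α i) => v.1 = i) =
      (Finset.univ : Finset (Fin (α i))).map ⟨Sigma.mk i, sigma_mk_injective⟩ := by
    ext ⟨j, x⟩
    simp only [Finset.mem_filter, Finset.mem_univ, true_and, Finset.mem_map,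
      Function.Embedding.coeFn_mk]
    constructor
    · rintro rfl
      exact ⟨x, rfl⟩
    · rintro ⟨y, hy⟩
      exact (congrArg Sigma.fst hy).symm
  rw [h, Finset.card_map, Finset.card_univ, Fintype.card_fin]
  rfl

/-- The polynomial in one variable `x = u_p - 1` contributed by the edges (and, for diagonal `p`,
vertices) of colour `p` to the weight of a graph with `m` edges of that colour. -/
noncomputable def colourFactor {K : Type*} [Field K] (α : Fin n → ℕ) (p : Pairs n) (m : ℕ) :
    Polynomial K :=
  if p.1.1 = p.1.2 then
    (Polynomial.X * (Polynomial.X + 2)) ^ m * (Polynomial.X + 1) ^ α p.1.1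
  else Polynomial.X ^ m

theorem colourFactor_diag {K : Type*} [Field K] (α : Fin n → ℕ) (i : Fin n) (m : ℕ) :
    colourFactor (K := K) α (diag i) m =
      (Polynomial.X * (Polynomial.X + 2)) ^ m * (Polynomial.X + 1) ^ α i :=
  if_pos rfl

/-- Off the diagonal `X ^ m` forces equality with `k`; on the diagonal the divisor `X ^ m` forces `m
≤ k`. Together these conditions define `SSet k`. -/
theorem prod_coeff_colourFactor {K : Type*} [Field K] (α : Fin n → ℕ) (k m : Pairs n → ℕ) :
    ∏ p, (colourFactor (K := K) α p (m p)).coeff (k p) =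
      if m ∈ SSet k then (cCoeff α k m : K) else 0 := by
  split_ifs with h
  · rw [mem_SSet] at h
    rw [cCoeff]
    push_cast
    symm
    refine Fintype.prod_of_injective diag diag_injective _ _ ?_ ?_
    · intro p hp
      have hne : p.1.1 ≠ p.1.2 := fun h => hp ⟨p.1.1, (eq_diag h).symm⟩
      rw [colourFactor, if_neg hne, h.2 p (lt_of_le_of_ne p.2 hne), Polynomial.coeff_X_pow_self]
    · intro i
      rw [colourFactor_diag, coeff_X_mul_X_add_two_pow, if_pos (h.1 i)]
  · rw [mem_SSet] at h
    rw [Finset.prod_eq_zero_iff]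
    by_contra! hc
    refine h ⟨fun i => ?_, fun p hp => ?_⟩
    · have := hc (diag i) (Finset.mem_univ _)
      rw [colourFactor_diag, coeff_X_mul_X_add_two_pow] at this
      by_contra hlt
      exact this (if_neg hlt)
    · have := hc p (Finset.mem_univ _)
      rw [colourFactor, if_neg hp.ne, Polynomial.coeff_X_pow] at this
      by_contra hne
      exact this (if_neg (Ne.symm hne))

theorem prod_mul_graphWeight_X_add_one {K : Type*} [Field K] (α : Fin n → ℕ)
    (G : SimpleGraph ((i : Fin n) × Fin (α i))) :
    (∏ v : (i : Fin n) × Fin (α i), (MvPolynomial.X (diag v.1) + 1 : MvPolynomial (Pairs n) K)) *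
        graphWeight (fun e => pairWeight
          (fun p => (MvPolynomial.X p + 1 : MvPolynomial (Pairs n) K)) (edgeColour Sigma.fst e)) G =
      ∏ p : Pairs n, Polynomial.aeval (MvPolynomial.X p : MvPolynomial (Pairs n) K)
        (colourFactor (K := K) α p {e ∈ G.edgeSet | e.map Sigma.fst = s(p.1.1, p.1.2)}.ncard) := by
  rw [graphWeight_edgeColour]
  have h1 : (∏ v : (i : Fin n) × Fin (α i),
      (MvPolynomial.X (diag v.1) + 1 : MvPolynomial (Pairs n) K)) =
      ∏ p : Pairs n, if p.1.1 = p.1.2 then (MvPolynomial.X p + 1) ^ α p.1.1 else 1 := by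
    rw [Fintype.prod_sigma]
    refine Fintype.prod_of_injective diag diag_injective _ _ ?_ ?_
    · intro p hp
      exact if_neg fun h => hp ⟨p.1.1, (eq_diag h).symm⟩
    · intro i
      change ∏ _v : Fin (α i), (MvPolynomial.X (diag i) + 1 : MvPolynomial (Pairs n) K) = _
      rw [Finset.prod_const, Finset.card_univ, Fintype.card_fin]
      exact (if_pos rfl).symm
  rw [h1, ← Finset.prod_mul_distrib]
  refine Finset.prod_congr rfl fun p _ => ?_
  unfold colourFactor pairWeight
  split_ifs
  · simp only [map_mul, map_pow, map_add, Polynomial.aeval_X, map_one, map_ofNat]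
    ring
  · simp

open Classical in
theorem coeff_connSum_X_add_one {K : Type*} [Field K] (α : Fin n → ℕ)
    [Nonempty ((i : Fin n) × Fin (α i))] (k : Pairs n → ℕ) :
    MvPolynomial.coeff (Finsupp.equivFunOnFinite.symm k)
      (connSum (Sigma.fst : ((i : Fin n) × Fin (α i)) → Fin n)
        fun p => (MvPolynomial.X p + 1 : MvPolynomial (Pairs n) K)) =
      ∑ p ∈ SSet k, (cCoeff α k p : K) * (connGraphCount α p : K) := by
  set e : SimpleGraph ((i : Fin n) × Fin (α i)) → Pairs n → ℕ := fun G p =>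
    {e ∈ G.edgeSet | e.map Sigma.fst = s(p.1.1, p.1.2)}.ncard with he
  rw [connSum, connGraphSum, Finset.mul_sum, MvPolynomial.coeff_sum,
    Finset.sum_congr rfl (g := fun G => if e G ∈ SSet k then (cCoeff α k (e G) : K) else 0)]
  -- Connected graphs are grouped by their vector of edge counts.
  · rw [← Finset.sum_filter, ← Finset.sum_fiberwise_of_maps_to (t := SSet k) (g := e)
      fun G hG => (Finset.mem_filter.1 hG).2]
    refine Finset.sum_congr rfl fun p hp => ?_
    rw [Finset.sum_congr rfl (g := fun _ => (cCoeff α k p : K))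
      fun G hG => by rw [(Finset.mem_filter.1 hG).2], Finset.sum_const, nsmul_eq_mul, mul_comm]
    congr 2
    rw [connGraphCount, Nat.card_eq_fintype_card, Fintype.card_subtype]
    congr 1
    ext G
    simp only [Finset.mem_filter, Finset.mem_univ, true_and,
      supportedOn_univ_and_connectedOn_univ]
    constructor
    · rintro ⟨⟨h1, -⟩, h3⟩
      exact ⟨h1, fun q => congrFun h3 q⟩
    · rintro ⟨h1, h2⟩
      have h3 : e G = p := funext h2
      exact ⟨⟨h1, h3 ▸ hp⟩, h3⟩
  · intro G _
    rw [prod_mul_graphWeight_X_add_one, coeff_prod_aeval_X]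
    exact prod_coeff_colourFactor α k (e G)

/-- A connected graph has at least one edge fewer than vertices. -/
theorem connGraphCount_eq_zero (α : Fin n → ℕ) (p : Pairs n → ℕ)
    (h : (∑ q, p q) + 1 < ∑ i, α i) : connGraphCount α p = 0 := by
  classical
  rw [connGraphCount, Nat.card_eq_zero]
  left
  refine ⟨fun ⟨G, hG, hp⟩ => ?_⟩
  have h1 := hG.card_vert_le_card_edgeSet_add_one
  rw [← sum_ncard_edges Sigma.fst, Finset.sum_congr rfl fun q _ => hp q] at h1
  simp only [Nat.card_eq_fintype_card, Fintype.card_sigma, Fintype.card_fin] at h1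
  exact absurd h1 h.not_ge

theorem sum_SSet_of_sum_add_one_eq {K : Type*} [Field K] (α : Fin n → ℕ) (k : Pairs n → ℕ)
    (hk : (∑ e, k e) + 1 = ∑ i, α i) :
    ∑ p ∈ SSet k, (cCoeff α k p : K) * (connGraphCount α p : K) =
      2 ^ tSum k * (connGraphCount α k : K) := by
  rw [Finset.sum_eq_single k]
  · congr 1
    -- For `p = k` the inner sum is the single term `j = 0`, equal to `2 ^ k_ii`.
    simp [cCoeff, tSum, Finset.prod_pow_eq_pow_sum]
  · intro p hp hpk
    have hle : p ≤ k := Finset.mem_Iic.1 (Finset.mem_filter.1 hp).1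
    obtain ⟨e, he⟩ := Function.ne_iff.1 hpk
    have : ∑ e, p e < ∑ e, k e :=
      Finset.sum_lt_sum (fun e _ => hle e) ⟨e, Finset.mem_univ e, lt_of_le_of_ne (hle e) he⟩
    rw [connGraphCount_eq_zero α p (by omega), Nat.cast_zero, mul_zero]
  · intro h
    exact absurd ((mem_SSet k k).2 ⟨fun _ => le_rfl, fun _ _ => rfl⟩) h

end Main

end QuiverDeformation

theorem mainTheorem5 {𝕜 : Type*} [RCLike 𝕜] (n : ℕ) (α : Fin n → ℕ) (hα : α ≠ 0) :
    ∃ L : MvPolynomial (QuiverDeformation.Pairs n) 𝕜,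
      (∀ u : QuiverDeformation.Pairs n → 𝕜,
        Filter.Tendsto
          (fun q : 𝕜 => (q - 1) ^ ((∑ i, α i) - 1) * QuiverDeformation.AFun α u q)
          (nhdsWithin 1 {1}ᶜ) (nhds (MvPolynomial.eval u L))) ∧
      (∀ k : QuiverDeformation.Pairs n → ℕ,
        QuiverDeformation.coeffAtOne k L =
          1 / ((∏ i, (α i).factorial : ℕ) : 𝕜) *
            ∑ p ∈ QuiverDeformation.SSet k,
              (QuiverDeformation.cCoeff α k p : 𝕜) *
                (QuiverDeformation.connGraphCount α p : 𝕜)) ∧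
      (∀ k : QuiverDeformation.Pairs n → ℕ, (∑ e, k e) + 1 = ∑ i, α i →
        QuiverDeformation.coeffAtOne k L =
          1 / ((∏ i, (α i).factorial : ℕ) : 𝕜) *
            (2 ^ QuiverDeformation.tSum k * (QuiverDeformation.connGraphCount α k : 𝕜))) := by
  open QuiverDeformation in
  obtain ⟨i, hi⟩ := Function.ne_iff.1 hα
  have : Nonempty ((i : Fin n) × Fin (α i)) := ⟨⟨i, ⟨0, Nat.pos_of_ne_zero hi⟩⟩⟩
  set c : ((i : Fin n) × Fin (α i)) → Fin n := Sigma.fst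
  have h0 : ((∏ i, (α i).factorial : ℕ) : 𝕜) ≠ 0 :=
    Nat.cast_ne_zero.2 (Finset.prod_ne_zero_iff.2 fun i _ => Nat.factorial_ne_zero _)
  have hcoeff : ∀ k : Pairs n → ℕ,
      coeffAtOne k (MvPolynomial.C (1 / ((∏ i, (α i).factorial : ℕ) : 𝕜)) *
        connSum c MvPolynomial.X) =
      1 / ((∏ i, (α i).factorial : ℕ) : 𝕜) *
        ∑ p ∈ SSet k, (cCoeff α k p : 𝕜) * (connGraphCount α p : 𝕜) := by
    intro k
    have h1 := map_connSum (R := MvPolynomial (Pairs n) 𝕜) (MvPolynomial.aeval (R := 𝕜)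
      (fun p : Pairs n => (MvPolynomial.X p + 1 : MvPolynomial (Pairs n) 𝕜))).toRingHom c
      MvPolynomial.X
    simp only [AlgHom.toRingHom_eq_coe, RingHom.coe_coe, MvPolynomial.aeval_X] at h1
    rw [coeffAtOne, map_mul, h1, MvPolynomial.aeval_C, MvPolynomial.algebraMap_eq,
      MvPolynomial.coeff_C_mul, coeff_connSum_X_add_one]
  -- The limit polynomial is the connected graph sum with the variables themselves as `u`, divided
  -- by `α!`.
  refine ⟨MvPolynomial.C (1 / ((∏ i, (α i).factorial : ℕ) : 𝕜)) * connSum c MvPolynomial.X,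
    fun u => ?_, hcoeff, fun k hk => ?_⟩
  · have h1 := map_connSum (MvPolynomial.eval u) c MvPolynomial.X
    simp only [MvPolynomial.eval_X] at h1
    rw [map_mul, h1, MvPolynomial.eval_C, connSum_eq_coeff_mvLog, colourCount_univ_sigma,
      ← mul_assoc]
    have h2 : (multiFactorial (Finsupp.equivFunOnFinite.symm α) : 𝕜) =
      ((∏ i, (α i).factorial : ℕ) : 𝕜) := rfl
    rw [h2, one_div, inv_mul_cancel₀ h0, one_mul]
    exact tendsto_pow_mul_AFun u hα
  · rw [hcoeff, sum_SSet_of_sum_add_one_eq α k hk]
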